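/- Let $n\ge 1$ be an integer. A convex body in $\mathbb{R}^n$ is a compact convex set with non-empty interior. For a convex body $C\subset\mathbb{R}^n$ and $X\subseteq\mathbb{R}^n$ put $B^+(X)=\bigcap_{v\in X}(C+v)$ (so $B^+(\emptyset)=\mathbb{R}^n$), and let $$\mathcal{D}_C=\{K\subseteq\mathbb{R}^n : K=B^+(K)\},\qquad \widetilde{\mathcal{D}}_C=\{K\subseteq\mathbb{R}^n : K=B^+(X)\text{ for some }X\subseteq\mathbb{R}^n\text{ with }X\subseteq B^+(X)\}.$$ The covering (illumination) number $i(K)$ of $K\subseteq\mathbb{R}^n$ is the minimum number of positive homothetic copies $v+rK$ of $K$ with ratios $0<r<1$ that cover $K$ ($i(K)=\infty$ if there is no finite cover), and for a family $\mathcal{F}$ of sets $i(\mathcal{F})=\sup\{i(K):K\in\mathcal{F}\}$. The Banach–Mazur distance is $$d(K,L)=\inf\{\lambda>0 : K\subseteq T(L)\subseteq \lambda K+v\text{ for some non-singular affine map }T\text{ of }\mathbb{R}^n\text{ and some }v\in\mathbb{R}^n\},$$ with $\inf\emptyset=\infty$. Theorem. For every $n\ge 1$ and every convex body $C\subset\mathbb{R}^n$,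 if $\mathcal{D}_C$ is non-empty then $i(\mathcal{D}_C)$ is finite and is attained by a member of $\mathcal{D}_C$, and likewise for $\widetilde{\mathcal{D}}_C$. Moreover there is a $\delta>1$ such that for every convex body $K\subset\mathbb{R}^n$: (1) if $d(K,L)<\delta$ for some $L\in\mathcal{D}_C$, then $i(K)\le i(\mathcal{D}_C)$; (2) if $d(K,L)<\delta$ for some $L\in\widetilde{\mathcal{D}}_C$, then $i(K)\le i(\widetilde{\mathcal{D}}_C)$. -/

import Mathlib

open scoped Pointwise ENNReal

/-- A convex body: a compact convex set with non-empty interior. -/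
def IsFullConvexBody {n : ℕ} (C : Set (EuclideanSpace ℝ (Fin n))) : Prop :=
  IsCompact C ∧ Convex ℝ C ∧ (interior C).Nonempty

/-- `B⁺(X)`: the intersection of the translates `C + v` with `v ∈ X`. It is the whole space when
`X` is empty. -/
def ballPlus {n : ℕ} (C X : Set (EuclideanSpace ℝ (Fin n))) : Set (EuclideanSpace ℝ (Fin n)) :=
  ⋂ v ∈ X, (v +ᵥ C)

/-- The family `D_C` of the sets `K` with `K = B⁺(K)`. -/
def familyD {n : ℕ} (C : Set (EuclideanSpace ℝ (Fin n))) :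
    Set (Set (EuclideanSpace ℝ (Fin n))) :=
  {K | K = ballPlus C K}

/-- The family of the sets `K = B⁺(X)` for some `X` with `X ⊆ B⁺(X)`. The choice `X = ∅`
contributes the whole space, which is at infinite distance from every convex body. -/
def familyDT {n : ℕ} (C : Set (EuclideanSpace ℝ (Fin n))) :
    Set (Set (EuclideanSpace ℝ (Fin n))) :=
  {K | ∃ X : Set (EuclideanSpace ℝ (Fin n)), X ⊆ ballPlus C X ∧ K = ballPlus C X}

/-- `K` is covered by `m` positive homothetic copies of itself, with ratios less than one. -/
def IsCoveredByHomothets {n : ℕ} (K : Set (EuclideanSpace ℝ (Fin n))) (m : ℕ) : Prop :=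
  ∃ (r : Fin m → ℝ) (v : Fin m → EuclideanSpace ℝ (Fin n)),
    (∀ j, 0 < r j ∧ r j < 1) ∧ K ⊆ ⋃ j, (v j +ᵥ (r j • K))

/-- The covering (illumination) number `i(K)`; it is `⊤` if no finite covering exists. -/
noncomputable def coveringNumber {n : ℕ} (K : Set (EuclideanSpace ℝ (Fin n))) : ℕ∞ :=
  ⨅ (m : ℕ) (_ : IsCoveredByHomothets K m), (m : ℕ∞)

/-- `i(F)`, the supremum of the covering numbers of the members of `F`. -/
noncomputable def familyCoveringNumber {n : ℕ}
    (F : Set (Set (EuclideanSpace ℝ (Fin n)))) : ℕ∞ :=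
  sSup (coveringNumber '' F)

/-- The (multiplicative) Banach–Mazur distance: the infimum of those `r > 0` for which some
non-singular affine image of `L` lies between `K` and a homothetic copy of `K` of ratio `r`
(the infimum of the empty set is `⊤`). -/
noncomputable def banachMazurDist {n : ℕ} (K L : Set (EuclideanSpace ℝ (Fin n))) : ℝ≥0∞ :=
  ⨅ (r : ℝ) (_ : 0 < r ∧
    ∃ (T : EuclideanSpace ℝ (Fin n) ≃ᵃ[ℝ] EuclideanSpace ℝ (Fin n))
      (v : EuclideanSpace ℝ (Fin n)), K ⊆ T '' L ∧ T '' L ⊆ v +ᵥ (r • K)),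
    ENNReal.ofReal r

/-! The proof combines compactness with semicontinuity of the covering number. Covering by `m`
smaller homothets has slack, so it passes from `M` to every `K` squeezed between two copies of `M`
of nearly equal ratios (`IsCoveredByHomothets.exists_forall_homotheticallyClose`).

When `X ⊆ B⁺(X)` is nonempty, some ball lies in all translates `C + v`, `v ∈ X`
(`exists_forall_add_mem`). Contracting towards its center absorbs small displacements of the
centers, so `B⁺(X)` varies continuously with `X` in this sense
(`exists_forall_homotheticallyClose_ballPlus`). After a translation `0 ∈ X`, so `X ⊆ C`, and the
admissible `X` form a Hausdorff-compact set. Finitely many neighbourhoods then control the family: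
the largest covering number of their centers is attained and bounds all others, and the smallest
tolerance serves as `δ`. -/

/-! ### Homothetic closeness and coverings by homothets -/

/-- `K` contains a homothetic copy of `M` and is contained in another one, the ratios of the two
copies having a quotient below `θ`. -/
def HomotheticallyClose {V : Type*} [AddCommGroup V] [Module ℝ V] (θ : ℝ) (M K : Set V) : Prop :=
  ∃ (a b : V) (s t : ℝ), 0 < s ∧ 0 < t ∧ t < θ * s ∧
    (∀ x ∈ M, a + s • x ∈ K) ∧ ∀ y ∈ K, ∃ x ∈ M, y = b + t • x

theorem isCoveredByHomothets_iff {n m : ℕ} {K : Set (EuclideanSpace ℝ (Fin n))} :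
    IsCoveredByHomothets K m ↔
      ∃ (r : Fin m → ℝ) (v : Fin m → EuclideanSpace ℝ (Fin n)),
        (∀ j, 0 < r j ∧ r j < 1) ∧ ∀ x ∈ K, ∃ j, ∃ y ∈ K, x = v j + r j • y := by
  simp only [IsCoveredByHomothets, Set.subset_def, Set.mem_iUnion, Set.mem_vadd_set,
    Set.mem_smul_set, vadd_eq_add]
  refine exists_congr fun r => exists_congr fun v => and_congr_right fun _ =>
    forall₂_congr fun x _ => exists_congr fun j => ?_
  constructor
  · rintro ⟨_, ⟨y, hy, rfl⟩, h⟩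
    exact ⟨y, hy, h.symm⟩
  · rintro ⟨y, hy, h⟩
    exact ⟨_, ⟨y, hy, rfl⟩, h.symm⟩

/-- Covering by homothets is an open condition. -/
theorem IsCoveredByHomothets.exists_forall_homotheticallyClose {n m : ℕ}
    {M : Set (EuclideanSpace ℝ (Fin n))} (hM : IsCoveredByHomothets M m) :
    ∃ θ : ℝ, 1 < θ ∧ ∀ K, HomotheticallyClose θ M K → IsCoveredByHomothets K m := by
  obtain ⟨r, v, hr, hcov⟩ := isCoveredByHomothets_iff.1 hM
  have hev : ∀ᶠ θ : ℝ in nhdsWithin 1 (Set.Ioi 1), 1 < θ ∧ ∀ j, θ * r j < 1 := by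
    refine (eventually_nhdsWithin_of_forall fun θ hθ => hθ).and (Filter.eventually_all.2 fun j => ?_)
    refine Filter.Eventually.filter_mono nhdsWithin_le_nhds ?_
    have hc : ContinuousAt (fun θ : ℝ => θ * r j) 1 := by fun_prop
    exact hc.eventually_lt continuousAt_const (by simpa using (hr j).2)
  obtain ⟨θ, hθ, hθr⟩ := hev.exists
  refine ⟨θ, hθ, fun K ⟨a, b, s, t, hs, ht, hst, hin, hout⟩ => isCoveredByHomothets_iff.2 ?_⟩
  -- Cover the outer copy `b + t • M` by the images of the cover of `M`, and enlarge each piece by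
  -- replacing `M` with `s⁻¹ • (K - a)`; the new ratio is `(t / s) * r j < θ * r j < 1`.
  refine ⟨fun j => t * r j / s, fun j => b + t • v j - (t * r j / s) • a, fun j => ⟨?_, ?_⟩, ?_⟩
  · have := (hr j).1
    positivity
  · rw [div_lt_one hs]
    nlinarith [hθr j, (hr j).1]
  · intro y hy
    obtain ⟨x, hx, rfl⟩ := hout y hy
    obtain ⟨j, w, hw, rfl⟩ := hcov x hx
    refine ⟨j, _, hin w hw, ?_⟩
    have : (t * r j / s) • (s • w) = (t * r j) • w := by
      rw [smul_smul, div_mul_cancel₀ _ hs.ne']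
    simp only [smul_add, this, smul_smul]
    abel

/-- Conjugating a homothety by an affine map preserves its ratio. -/
theorem AffineEquiv.map_add_smul {V : Type*} [AddCommGroup V] [Module ℝ V] (T : V ≃ᵃ[ℝ] V)
    (v y : V) (r : ℝ) : T (v + r • y) = (T.linear v + (1 - r) • T 0) + r • T y := by
  have h (x : V) : T x = T.linear x + T 0 := by
    simpa using T.map_vadd 0 x
  rw [h (v + r • y), h y, map_add, map_smul]
  module

theorem IsCoveredByHomothets.image {n m : ℕ} {K : Set (EuclideanSpace ℝ (Fin n))}
    (hK : IsCoveredByHomothets K m)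
    (T : EuclideanSpace ℝ (Fin n) ≃ᵃ[ℝ] EuclideanSpace ℝ (Fin n)) :
    IsCoveredByHomothets (T '' K) m := by
  obtain ⟨r, v, hr, hcov⟩ := isCoveredByHomothets_iff.1 hK
  refine isCoveredByHomothets_iff.2 ⟨r, fun j => T.linear (v j) + (1 - r j) • T 0, hr, ?_⟩
  rintro _ ⟨x, hx, rfl⟩
  obtain ⟨j, y, hy, rfl⟩ := hcov x hx
  exact ⟨j, T y, ⟨y, hy, rfl⟩, T.map_add_smul _ _ _⟩

theorem exists_of_banachMazurDist_lt {n : ℕ} {K L : Set (EuclideanSpace ℝ (Fin n))} {δ : ℝ}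
    (h : banachMazurDist K L < ENNReal.ofReal δ) :
    ∃ r : ℝ, 0 < r ∧ r < δ ∧
      ∃ (T : EuclideanSpace ℝ (Fin n) ≃ᵃ[ℝ] EuclideanSpace ℝ (Fin n))
        (v : EuclideanSpace ℝ (Fin n)), K ⊆ T '' L ∧ T '' L ⊆ v +ᵥ (r • K) := by
  simp only [banachMazurDist, iInf_lt_iff] at h
  obtain ⟨r, ⟨hr, T, v, h₁, h₂⟩, hlt⟩ := h
  exact ⟨r, hr, (ENNReal.ofReal_lt_ofReal_iff_of_nonneg hr.le).1 hlt, T, v, h₁, h₂⟩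

/-! ### Covering numbers of compact families -/

theorem coveringNumber_le {n m : ℕ} {K : Set (EuclideanSpace ℝ (Fin n))}
    (h : IsCoveredByHomothets K m) : coveringNumber K ≤ m :=
  iInf₂_le m h

theorem exists_coveringNumber_eq {n m : ℕ} {K : Set (EuclideanSpace ℝ (Fin n))}
    (h : IsCoveredByHomothets K m) :
    ∃ k : ℕ, IsCoveredByHomothets K k ∧ coveringNumber K = k := by
  classical
  have hex : ∃ k, IsCoveredByHomothets K k := ⟨m, h⟩
  refine ⟨Nat.find hex, Nat.find_spec hex, le_antisymm (coveringNumber_le (Nat.find_spec hex)) ?_⟩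
  exact le_iInf₂ fun k hk => Nat.cast_le.2 (Nat.find_min' hex hk)

/-- A nonempty family that is compact up to homothetic closeness attains its covering number, and
this number bounds the covering numbers of all sets near the family. -/
theorem familyCoveringNumber_attained_and_stable {n : ℕ}
    {F : Set (Set (EuclideanSpace ℝ (Fin n)))} (hF : F.Nonempty)
    (hfin : ∀ M ∈ F, ∃ m, IsCoveredByHomothets M m)
    (hcomp : ∀ θ : Set (EuclideanSpace ℝ (Fin n)) → ℝ, (∀ M ∈ F, 1 < θ M) →
      ∃ S : Finset (Set (EuclideanSpace ℝ (Fin n))), (∀ M ∈ S, M ∈ F) ∧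
        ∀ L ∈ F, ∃ M ∈ S, HomotheticallyClose (θ M) M L) :
    (∃ M ∈ F, coveringNumber M = familyCoveringNumber F ∧ coveringNumber M ≠ ⊤) ∧
      ∃ δ : ℝ, 1 < δ ∧ ∀ K L : Set (EuclideanSpace ℝ (Fin n)), L ∈ F →
        banachMazurDist K L < ENNReal.ofReal δ → coveringNumber K ≤ familyCoveringNumber F := by
  have hθ : ∀ M : Set (EuclideanSpace ℝ (Fin n)), ∃ θ : ℝ, M ∈ F → 1 < θ ∧
      ∃ m : ℕ, coveringNumber M = m ∧
        ∀ K, HomotheticallyClose (θ * θ) M K → IsCoveredByHomothets K m := by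
    intro M
    by_cases hM : M ∈ F
    · obtain ⟨m, hm⟩ := hfin M hM
      obtain ⟨k, hk, hMk⟩ := exists_coveringNumber_eq hm
      obtain ⟨θ, hθ, h⟩ := hk.exists_forall_homotheticallyClose
      -- The tolerance is split into two factors: one for passing from `M` to a member `L` of the
      -- family, one for passing from `L` to a nearby `K`.
      refine ⟨√θ, fun _ => ⟨Real.lt_sqrt_of_sq_lt (by simpa using hθ), k, hMk, ?_⟩⟩
      rwa [Real.mul_self_sqrt (by linarith)]
    · exact ⟨0, fun h => absurd h hM⟩
  choose θ hθ using hθ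
  obtain ⟨S, hSF, hS⟩ := hcomp θ fun M hM => (hθ M hM).1
  have hSne : S.Nonempty := by
    obtain ⟨L, hL⟩ := hF
    obtain ⟨M, hM, -⟩ := hS L hL
    exact ⟨M, hM⟩
  have hle : ∀ L ∈ F, ∃ M ∈ S, coveringNumber L ≤ coveringNumber M := by
    intro L hL
    obtain ⟨M, hM, a, b, s, t, hs, ht, hst, h⟩ := hS L hL
    obtain ⟨h1, m, hm, hcov⟩ := hθ M (hSF M hM)
    refine ⟨M, hM, hm ▸ coveringNumber_le (hcov L ⟨a, b, s, t, hs, ht, ?_, h⟩)⟩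
    nlinarith [mul_pos (sub_pos.2 h1) hs]
  refine ⟨?_, ?_⟩
  · obtain ⟨M, hM, hmax⟩ := S.exists_max_image coveringNumber hSne
    refine ⟨M, hSF M hM, le_antisymm (le_sSup ⟨M, hSF M hM, rfl⟩) (sSup_le ?_), ?_⟩
    · rintro _ ⟨L, hL, rfl⟩
      obtain ⟨M', hM', h⟩ := hle L hL
      exact h.trans (hmax M' hM')
    · obtain ⟨-, m, hm, -⟩ := hθ M (hSF M hM)
      simp [hm]
  · obtain ⟨M₀, hM₀, hmin⟩ := S.exists_min_image θ hSne
    refine ⟨θ M₀, (hθ M₀ (hSF M₀ hM₀)).1, fun K L hL hKL => ?_⟩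
    obtain ⟨r, hr, hrδ, T, v, h₁, h₂⟩ := exists_of_banachMazurDist_lt hKL
    obtain ⟨M, hM, a, b, s, t, hs, ht, hst, hin, hout⟩ := hS L hL
    obtain ⟨h1, m, hm, hcov⟩ := hθ M (hSF M hM)
    have hclose : HomotheticallyClose (θ M * θ M) M (T.symm '' K) := by
      -- Chosen so that `T⁻¹(v + r • K) = v' + r • T⁻¹(K)`.
      set v' := T.symm.linear v + (1 - r) • T.symm 0 with hv'
      refine ⟨r⁻¹ • (a - v'), b, s / r, t, by positivity, ht, ?_, ?_, ?_⟩
      · have : r < θ M := hrδ.trans_le (hmin M hM)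
        rw [mul_div_assoc', lt_div_iff₀ hr]
        nlinarith [mul_pos (sub_pos.2 h1) hs, mul_pos (sub_pos.2 hst) hr,
          mul_pos (sub_pos.2 this) (mul_pos (lt_trans one_pos h1) hs)]
      · intro x hx
        obtain ⟨_, ⟨k, hk, rfl⟩, hkx⟩ := h₂ ⟨_, hin x hx, rfl⟩
        refine ⟨k, hk, ?_⟩
        have : a + s • x = v' + r • T.symm k := by
          rw [hv', ← T.symm.map_add_smul, ← T.symm_apply_apply (a + s • x)]
          exact congrArg T.symm hkx.symm
        have h' : r • T.symm k = (a - v') + s • x := by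
          rw [sub_add_eq_add_sub, this, add_sub_cancel_left]
        rw [div_eq_inv_mul, ← smul_smul, ← smul_add, ← h', inv_smul_smul₀ hr.ne']
      · rintro _ ⟨k, hk, rfl⟩
        obtain ⟨y, hy, rfl⟩ := h₁ hk
        simpa using hout y hy
    have hK := (hcov _ hclose).image T
    rw [Set.image_image] at hK
    simp only [AffineEquiv.apply_symm_apply, Set.image_id'] at hK
    exact (hm ▸ coveringNumber_le hK).trans (le_sSup ⟨M, hSF M hM, rfl⟩)

/-! ### The sets `B⁺(X)` and their dependence on `X` -/

theorem mem_ballPlus {n : ℕ} {C X : Set (EuclideanSpace ℝ (Fin n))}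
    {x : EuclideanSpace ℝ (Fin n)} : x ∈ ballPlus C X ↔ ∀ v ∈ X, x - v ∈ C := by
  simp only [ballPlus, Set.mem_iInter, Set.mem_vadd_set_iff_neg_vadd_mem, vadd_eq_add,
    neg_add_eq_sub]

theorem convex_ballPlus {n : ℕ} {C : Set (EuclideanSpace ℝ (Fin n))} (hC : Convex ℝ C)
    (X : Set (EuclideanSpace ℝ (Fin n))) : Convex ℝ (ballPlus C X) :=
  convex_iInter₂ fun v _ => hC.vadd v

theorem isCompact_ballPlus {n : ℕ} {C X : Set (EuclideanSpace ℝ (Fin n))} (hC : IsCompact C)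
    (hX : X.Nonempty) : IsCompact (ballPlus C X) := by
  obtain ⟨v, hv⟩ := hX
  exact (hC.vadd v).of_isClosed_subset (isClosed_biInter fun w _ => (hC.vadd w).isClosed)
    (Set.biInter_subset_of_mem hv)

/-- If `X ⊆ B⁺(X)` then some point lies well inside all the translates defining `B⁺(X)`. -/
theorem exists_forall_add_mem {n : ℕ} {C X : Set (EuclideanSpace ℝ (Fin n))}
    (hC : IsFullConvexBody C) (hX : X.Nonempty) (hXC : X ⊆ ballPlus C X) :
    ∃ z : EuclideanSpace ℝ (Fin n), ∃ ρ : ℝ, 0 < ρ ∧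
      ∀ v ∈ X, ∀ u : EuclideanSpace ℝ (Fin n), ‖u‖ ≤ ρ → z - v + u ∈ C := by
  obtain ⟨hCc, hCv, c, hc⟩ := hC
  obtain ⟨ρ, hρ, hball⟩ := Metric.nhds_basis_closedBall.mem_iff.1 (mem_interior_iff_mem_nhds.1 hc)
  have hY : convexHull ℝ X ⊆ ballPlus C X := convexHull_min hXC (convex_ballPlus hCv X)
  have hbdd : Bornology.IsBounded X := (isCompact_ballPlus hCc hX).isBounded.subset hXC
  -- `X` may be lower-dimensional, so only a relative interior point `x'` of its convex hull is
  -- available. Moving from `x'` away from any `v ∈ X` by the fraction `τ` stays in the hull, hence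
  -- in `B⁺(X)`; so `(1 + τ) • (x' - v) ∈ C`. Averaging this with a ball in `C` about `c` gives a
  -- ball of radius independent of `v`.
  obtain ⟨x, hx⟩ := hX.convexHull.intrinsicInterior (convex_convexHull ℝ X)
  have hxY : x ∈ convexHull ℝ X := intrinsicInterior_subset hx
  obtain ⟨x', hx', rfl⟩ := mem_intrinsicInterior.1 hx
  obtain ⟨ε, hε, hεY⟩ := Metric.mem_nhds_iff.1 (mem_interior_iff_mem_nhds.1 hx')
  obtain ⟨R, hR, hXR⟩ := hbdd.subset_closedBall_lt 0 (x' : EuclideanSpace ℝ (Fin n))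
  obtain ⟨τ, hτ, hτR⟩ : ∃ τ : ℝ, 0 < τ ∧ τ * R < ε :=
    ⟨ε / (2 * R), by positivity, by field_simp; norm_num⟩
  have hext : ∀ v ∈ X, (1 + τ) • ((x' : EuclideanSpace ℝ (Fin n)) - v) ∈ C := by
    intro v hv
    have hspan : (x' : EuclideanSpace ℝ (Fin n)) + τ • ((x' : EuclideanSpace ℝ (Fin n)) - v) ∈
        affineSpan ℝ (convexHull ℝ X) := by
      have := AffineMap.lineMap_mem (1 + τ)
        (subset_affineSpan ℝ _ (subset_convexHull ℝ X hv)) x'.2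
      convert this using 1
      rw [AffineMap.lineMap_apply_module]
      module
    have hmem : (⟨_, hspan⟩ : affineSpan ℝ (convexHull ℝ X)) ∈ Metric.ball x' ε := by
      rw [Metric.mem_ball, Subtype.dist_eq, dist_eq_norm, add_sub_cancel_left, norm_smul,
        Real.norm_of_nonneg hτ.le]
      have : ‖(x' : EuclideanSpace ℝ (Fin n)) - v‖ ≤ R := by
        simpa [dist_eq_norm, norm_sub_rev] using hXR hv
      nlinarith
    have := mem_ballPlus.1 (hY (hεY hmem)) v hv
    convert this using 1
    simp only
    module
  refine ⟨x' + (τ / (1 + τ)) • c, (τ / (1 + τ)) * ρ, by positivity, fun v hv u hu => ?_⟩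
  have hcu : c + ((1 + τ) / τ) • u ∈ C := by
    refine hball ?_
    rw [Metric.mem_closedBall, dist_eq_norm, add_sub_cancel_left, norm_smul,
      Real.norm_of_nonneg (by positivity)]
    calc (1 + τ) / τ * ‖u‖ ≤ (1 + τ) / τ * (τ / (1 + τ) * ρ) := by gcongr
      _ = ρ := by field_simp
  have := hCv (hext v hv) hcu (a := 1 / (1 + τ)) (b := τ / (1 + τ)) (by positivity)
    (by positivity) (by field_simp)
  convert this using 1
  rw [smul_add, smul_smul, smul_smul]
  have h₁ : 1 / (1 + τ) * (1 + τ) = 1 := by field_simp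
  have h₂ : τ / (1 + τ) * ((1 + τ) / τ) = 1 := by field_simp
  rw [h₁, h₂]
  module

/-- The displacement of a center is charged to the ball around `z`: `t • z + (1 - t) • y - v' = t •
(z - v + t⁻¹ • (v - v')) + (1 - t) • (y - v)`. -/
theorem combo_mem_ballPlus {n : ℕ} {C X X' : Set (EuclideanSpace ℝ (Fin n))} (hC : Convex ℝ C)
    {z : EuclideanSpace ℝ (Fin n)} {ρ t : ℝ} (ht : 0 < t) (ht' : t ≤ 1)
    (hz : ∀ v ∈ X, ∀ u : EuclideanSpace ℝ (Fin n), ‖u‖ ≤ ρ → z - v + u ∈ C)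
    (hX : ∀ v' ∈ X', ∃ v ∈ X, ‖v - v'‖ ≤ t * ρ) {y : EuclideanSpace ℝ (Fin n)}
    (hy : y ∈ ballPlus C X) : t • z + (1 - t) • y ∈ ballPlus C X' := by
  refine mem_ballPlus.2 fun v' hv' => ?_
  obtain ⟨v, hv, hvv⟩ := hX v' hv'
  have hu : ‖t⁻¹ • (v - v')‖ ≤ ρ := by
    rw [norm_smul, Real.norm_of_nonneg (by positivity), inv_mul_le_iff₀ ht]
    exact hvv
  have := hC (hz v hv _ hu) (mem_ballPlus.1 hy v hv) ht.le (sub_nonneg.2 ht') (by ring)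
  convert this using 1
  rw [smul_add, smul_inv_smul₀ ht.ne']
  module

theorem exists_forall_homotheticallyClose_ballPlus {n : ℕ}
    {C X : Set (EuclideanSpace ℝ (Fin n))} (hC : IsFullConvexBody C) (hX : X.Nonempty)
    (hXC : X ⊆ ballPlus C X) {θ : ℝ} (hθ : 1 < θ) :
    ∃ η : ℝ, 0 < η ∧ ∀ X' : Set (EuclideanSpace ℝ (Fin n)),
      (∀ v ∈ X, ∃ v' ∈ X', dist v v' < η) → (∀ v' ∈ X', ∃ v ∈ X, dist v' v < η) →
        HomotheticallyClose θ (ballPlus C X) (ballPlus C X') := by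
  obtain ⟨z, ρ, hρ, hz⟩ := exists_forall_add_mem hC hX hXC
  -- The two copies will have ratios `1 - t` and `(1 - t)⁻¹`.
  obtain ⟨t, ht, ht1, htθ⟩ : ∃ t : ℝ, 0 < t ∧ t < 1 ∧ 1 < θ * (1 - t) * (1 - t) := by
    have hc : ContinuousAt (fun t : ℝ => θ * (1 - t) * (1 - t)) 0 := by fun_prop
    have h : ∀ᶠ t : ℝ in nhdsWithin 0 (Set.Ioi 0), 1 < θ * (1 - t) * (1 - t) :=
      (continuousAt_const.eventually_lt hc (by simpa using hθ)).filter_mono nhdsWithin_le_nhds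
    obtain ⟨t, h₁, h₂, h₃⟩ := (h.and (Ioo_mem_nhdsGT one_pos)).exists
    exact ⟨t, h₂, h₃, h₁⟩
  -- Half of `ρ` is kept in reserve so that `z` is also deep, with radius `ρ / 2`, for the perturbed
  -- centers `X'`; the contraction then works in both directions.
  refine ⟨t * (ρ / 2), by positivity, fun X' h₁ h₂ => ?_⟩
  have hz' : ∀ v' ∈ X', ∀ u : EuclideanSpace ℝ (Fin n), ‖u‖ ≤ ρ / 2 → z - v' + u ∈ C := by
    intro v' hv' u hu
    obtain ⟨v, hv, hvv⟩ := h₂ v' hv'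
    rw [dist_comm, dist_eq_norm] at hvv
    have := hz v hv (v - v' + u) ((norm_add_le _ _).trans (by nlinarith))
    rwa [← add_assoc, sub_add_sub_cancel] at this
  refine ⟨t • z, -(t / (1 - t)) • z, 1 - t, (1 - t)⁻¹, by linarith, by simpa using ht1, ?_, ?_, ?_⟩
  · rw [inv_eq_one_div, div_lt_iff₀ (by linarith)]
    exact htθ
  · intro x hx
    refine combo_mem_ballPlus hC.2.1 ht ht1.le hz (fun v' hv' => ?_) hx
    obtain ⟨v, hv, hvv⟩ := h₂ v' hv'
    rw [dist_comm, dist_eq_norm] at hvv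
    exact ⟨v, hv, by nlinarith⟩
  · intro y hy
    refine ⟨_, combo_mem_ballPlus hC.2.1 ht ht1.le hz' (fun v hv => ?_) hy, ?_⟩
    · obtain ⟨v', hv', hvv⟩ := h₁ v hv
      rw [dist_comm, dist_eq_norm] at hvv
      exact ⟨v', hv', hvv.le⟩
    · have h0 : (1 - t) ≠ 0 := by linarith
      rw [smul_add, inv_smul_smul₀ h0, smul_smul, div_eq_inv_mul]
      module

/-- A copy of ratio `1 / 2` contains a ball of radius `ρ / 2`, and finitely many such balls cover a
compact set. -/
theorem exists_isCoveredByHomothets {n : ℕ} {L : Set (EuclideanSpace ℝ (Fin n))}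
    (hL : IsCompact L) {z : EuclideanSpace ℝ (Fin n)} {ρ : ℝ} (hρ : 0 < ρ)
    (hz : Metric.closedBall z ρ ⊆ L) : ∃ m, IsCoveredByHomothets L m := by
  obtain ⟨S, -, hS, hcov⟩ := hL.finite_cover_balls (half_pos hρ)
  lift S to Finset (EuclideanSpace ℝ (Fin n)) using hS
  refine ⟨S.card, isCoveredByHomothets_iff.2 ⟨fun _ => 1 / 2,
    fun j => (S.equivFin.symm j : EuclideanSpace ℝ (Fin n)) - (1 / 2 : ℝ) • z,
    fun _ => by norm_num, fun y hy => ?_⟩⟩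
  obtain ⟨x, hx, hyx⟩ := Set.mem_iUnion₂.1 (hcov hy)
  refine ⟨S.equivFin ⟨x, hx⟩, z + (2 : ℝ) • (y - x), hz ?_, ?_⟩
  · rw [Metric.mem_ball, dist_eq_norm] at hyx
    rw [Metric.mem_closedBall, dist_eq_norm, add_sub_cancel_left, norm_smul, Real.norm_two]
    linarith
  · simp only [Equiv.symm_apply_apply]
    module

theorem exists_isCoveredByHomothets_ballPlus {n : ℕ} {C X : Set (EuclideanSpace ℝ (Fin n))}
    (hC : IsFullConvexBody C) (hX : X.Nonempty) (hXC : X ⊆ ballPlus C X) :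
    ∃ m, IsCoveredByHomothets (ballPlus C X) m := by
  obtain ⟨z, ρ, hρ, hz⟩ := exists_forall_add_mem hC hX hXC
  refine exists_isCoveredByHomothets (isCompact_ballPlus hC.1 hX) hρ (z := z) fun y hy => ?_
  refine mem_ballPlus.2 fun v hv => ?_
  have := hz v hv (y - z) (by simpa [dist_eq_norm] using hy)
  convert this using 1
  abel

/-! ### Compactness of the space of centers -/

open TopologicalSpace in
theorem TopologicalSpace.NonemptyCompacts.exists_dist_lt {α : Type*} [MetricSpace α]
    {X Y : NonemptyCompacts α} {η : ℝ} (h : dist X Y < η) {x : α} (hx : x ∈ (X : Set α)) :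
    ∃ y ∈ (Y : Set α), dist x y < η := by
  rw [Metric.NonemptyCompacts.dist_eq] at h
  exact Metric.exists_dist_lt_of_hausdorffDist_lt hx h
    (Metric.hausdorffEDist_ne_top_of_nonempty_of_bounded X.nonempty Y.nonempty
      X.isCompact.isBounded Y.isCompact.isBounded)

open TopologicalSpace

/-- The nonempty compact sets `X` containing the origin with `X ⊆ B⁺(X)`. -/
def basedCenters {n : ℕ} (C : Set (EuclideanSpace ℝ (Fin n))) :
    Set (NonemptyCompacts (EuclideanSpace ℝ (Fin n))) :=
  {X | 0 ∈ (X : Set (EuclideanSpace ℝ (Fin n))) ∧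
    (X : Set (EuclideanSpace ℝ (Fin n))) ⊆ ballPlus C X}

/-- The nonempty compact sets `X` containing the origin with `X = B⁺(X)`. -/
def basedComplete {n : ℕ} (C : Set (EuclideanSpace ℝ (Fin n))) :
    Set (NonemptyCompacts (EuclideanSpace ℝ (Fin n))) :=
  {X | 0 ∈ (X : Set (EuclideanSpace ℝ (Fin n))) ∧
    (X : Set (EuclideanSpace ℝ (Fin n))) = ballPlus C X}

theorem basedComplete_subset {n : ℕ} (C : Set (EuclideanSpace ℝ (Fin n))) :
    basedComplete C ⊆ basedCenters C :=
  fun _ h => ⟨h.1, h.2.subset⟩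

theorem isClosed_basedCenters {n : ℕ} {C : Set (EuclideanSpace ℝ (Fin n))} (hC : IsClosed C) :
    IsClosed (basedCenters C) := by
  refine isClosed_of_closure_subset fun X hX => ?_
  rw [Metric.mem_closure_iff] at hX
  constructor
  · rw [← X.isCompact.isClosed.closure_eq, Metric.mem_closure_iff]
    intro ε hε
    obtain ⟨Y, hY, hXY⟩ := hX ε hε
    exact NonemptyCompacts.exists_dist_lt (dist_comm X Y ▸ hXY) hY.1
  · intro x hx
    refine mem_ballPlus.2 fun v hv => ?_
    rw [← hC.closure_eq, Metric.mem_closure_iff]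
    intro ε hε
    obtain ⟨Y, hY, hXY⟩ := hX (ε / 2) (half_pos hε)
    obtain ⟨x', hx', hxx⟩ := NonemptyCompacts.exists_dist_lt hXY hx
    obtain ⟨v', hv', hvv⟩ := NonemptyCompacts.exists_dist_lt hXY hv
    exact ⟨x' - v', mem_ballPlus.1 (hY.2 hx') v' hv',
      (dist_sub_sub_le x v x' v').trans_lt (by linarith)⟩

/-- Only `B⁺(X) ⊆ X` needs work in the limit: a point of `B⁺(X)`, pushed slightly towards the deep
point `z`, lies in `B⁺(Y) = Y` for an approximating `Y`, hence near `X`. -/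
theorem isClosed_basedComplete {n : ℕ} {C : Set (EuclideanSpace ℝ (Fin n))}
    (hC : IsFullConvexBody C) : IsClosed (basedComplete C) := by
  refine isClosed_of_closure_subset fun X hX => ?_
  obtain ⟨h0, hXC⟩ : X ∈ basedCenters C :=
    closure_minimal (basedComplete_subset C) (isClosed_basedCenters hC.1.isClosed) hX
  rw [Metric.mem_closure_iff] at hX
  refine ⟨h0, hXC.antisymm fun y hy => ?_⟩
  obtain ⟨z, ρ, hρ, hz⟩ := exists_forall_add_mem hC X.nonempty hXC
  rw [← X.isCompact.isClosed.closure_eq, Metric.mem_closure_iff]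
  intro ε hε
  -- The push costs `t * ‖y - z‖` and the Hausdorff approximation `t * ρ`.
  obtain ⟨t, ht, ht1, htε⟩ : ∃ t : ℝ, 0 < t ∧ t ≤ 1 ∧ t * (‖y - z‖ + ρ) < ε := by
    have hpos : 0 < ‖y - z‖ + ρ := by positivity
    refine ⟨min 1 (ε / (2 * (‖y - z‖ + ρ))), by positivity, min_le_left _ _, ?_⟩
    calc _ ≤ ε / (2 * (‖y - z‖ + ρ)) * (‖y - z‖ + ρ) := by gcongr; exact min_le_right _ _
      _ = ε / 2 := by field_simp
      _ < ε := by linarith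
  obtain ⟨Y, hY, hXY⟩ := hX (t * ρ) (by positivity)
  have hmem : t • z + (1 - t) • y ∈ ballPlus C (Y : Set (EuclideanSpace ℝ (Fin n))) := by
    refine combo_mem_ballPlus hC.2.1 ht ht1 hz (fun v' hv' => ?_) hy
    obtain ⟨v, hv, hvv⟩ := NonemptyCompacts.exists_dist_lt (dist_comm X Y ▸ hXY) hv'
    rw [dist_comm, dist_eq_norm] at hvv
    exact ⟨v, hv, hvv.le⟩
  rw [← hY.2] at hmem
  obtain ⟨x, hx, hxy⟩ := NonemptyCompacts.exists_dist_lt (dist_comm X Y ▸ hXY) hmem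
  refine ⟨x, hx, (dist_triangle y (t • z + (1 - t) • y) x).trans_lt ?_⟩
  have : dist y (t • z + (1 - t) • y) = t * ‖y - z‖ := by
    rw [dist_eq_norm, ← Real.norm_of_nonneg ht.le, ← norm_smul, Real.norm_of_nonneg ht.le]
    congr 1
    module
  nlinarith

/-- Since `0 ∈ X`, the inclusion `X ⊆ B⁺(X)` forces `X ⊆ C`, and the nonempty compact subsets of a
compact set form a compact space. -/
theorem isCompact_of_subset_basedCenters {n : ℕ} {C : Set (EuclideanSpace ℝ (Fin n))}
    (hC : IsCompact C) {P : Set (NonemptyCompacts (EuclideanSpace ℝ (Fin n)))}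
    (hP : IsClosed P) (hPC : P ⊆ basedCenters C) : IsCompact P := by
  refine (NonemptyCompacts.isCompact_subsets_of_isCompact hC).of_isClosed_subset hP
    fun X hX x hx => ?_
  simpa using mem_ballPlus.1 ((hPC hX).2 hx) 0 (hPC hX).1

/-- The covering statement for a family which, up to translation, consists of the sets `B⁺(X)` with
`X` in a closed set of centers. -/
theorem familyCoveringNumber_attained_and_stable_of_basedCenters {n : ℕ}
    {C : Set (EuclideanSpace ℝ (Fin n))} (hC : IsFullConvexBody C)
    {F : Set (Set (EuclideanSpace ℝ (Fin n)))} (hF : F.Nonempty)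
    (hFC : ∀ L ∈ F, ∃ X : Set (EuclideanSpace ℝ (Fin n)),
      X.Nonempty ∧ X ⊆ ballPlus C X ∧ L = ballPlus C X)
    {P : Set (NonemptyCompacts (EuclideanSpace ℝ (Fin n)))} (hP : IsClosed P)
    (hPC : P ⊆ basedCenters C)
    (hPF : ∀ X ∈ P, ballPlus C (X : Set (EuclideanSpace ℝ (Fin n))) ∈ F)
    (hFP : ∀ L ∈ F, ∃ X ∈ P, ∃ w : EuclideanSpace ℝ (Fin n),
      ∀ y, y ∈ L ↔ y - w ∈ ballPlus C (X : Set (EuclideanSpace ℝ (Fin n)))) :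
    (∃ M ∈ F, coveringNumber M = familyCoveringNumber F ∧ coveringNumber M ≠ ⊤) ∧
      ∃ δ : ℝ, 1 < δ ∧ ∀ K L : Set (EuclideanSpace ℝ (Fin n)), L ∈ F →
        banachMazurDist K L < ENNReal.ofReal δ →
          coveringNumber K ≤ familyCoveringNumber F := by
  classical
  refine familyCoveringNumber_attained_and_stable hF (fun M hM => ?_) fun θ hθ => ?_
  · obtain ⟨X, hX, hXC, rfl⟩ := hFC M hM
    exact exists_isCoveredByHomothets_ballPlus hC hX hXC
  have hnhd : ∀ X : NonemptyCompacts (EuclideanSpace ℝ (Fin n)), ∃ η : ℝ, 0 < η ∧ (X ∈ P →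
      ∀ Y, dist Y X < η → HomotheticallyClose (θ (ballPlus C X)) (ballPlus C X)
        (ballPlus C (Y : Set (EuclideanSpace ℝ (Fin n))))) := by
    intro X
    by_cases hX : X ∈ P
    · obtain ⟨η, hη, h⟩ := exists_forall_homotheticallyClose_ballPlus hC X.nonempty (hPC hX).2
        (hθ _ (hPF X hX))
      refine ⟨η, hη, fun _ Y hY => h Y (fun v hv => ?_) fun v hv => ?_⟩
      · exact NonemptyCompacts.exists_dist_lt (dist_comm Y X ▸ hY) hv
      · exact NonemptyCompacts.exists_dist_lt hY hv
    · exact ⟨1, one_pos, fun h => absurd h hX⟩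
  choose η hη hclose using hnhd
  obtain ⟨S, hSP, hS⟩ := (isCompact_of_subset_basedCenters hC.1 hP hPC).elim_nhds_subcover
    (fun X => Metric.ball X (η X)) fun X _ => Metric.ball_mem_nhds X (hη X)
  refine ⟨S.image fun X : NonemptyCompacts (EuclideanSpace ℝ (Fin n)) => ballPlus C X, ?_, fun L hL => ?_⟩
  · intro M hM
    obtain ⟨X, hX, rfl⟩ := Finset.mem_image.1 hM
    exact hPF X (hSP X hX)
  · obtain ⟨Y, hY, w, hw⟩ := hFP L hL
    obtain ⟨X, hX, hYX⟩ := Set.mem_iUnion₂.1 (hS hY)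
    refine ⟨_, Finset.mem_image_of_mem _ hX, ?_⟩
    obtain ⟨a, b, s, t, hs, ht, hst, hin, hout⟩ := hclose X (hSP X hX) Y hYX
    refine ⟨a + w, b + w, s, t, hs, ht, hst, fun x hx => (hw _).2 ?_, fun y hy => ?_⟩
    · convert hin x hx using 1
      abel
    · obtain ⟨x, hx, h⟩ := hout _ ((hw y).1 hy)
      exact ⟨x, hx, by rw [sub_eq_iff_eq_add.1 h]; abel⟩

/-! ### Normalizing the members of the two families -/

theorem sub_mem_of_mem_closure {V : Type*} [SeminormedAddCommGroup V] {C A B : Set V}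
    (hC : IsClosed C) (h : ∀ x ∈ A, ∀ v ∈ B, x - v ∈ C) {x v : V} (hx : x ∈ closure A)
    (hv : v ∈ closure B) : x - v ∈ C := by
  rw [← hC.closure_eq]
  exact map_mem_closure₂ continuous_sub hx hv h

theorem mem_ballPlus_image_sub {n : ℕ} {C X : Set (EuclideanSpace ℝ (Fin n))}
    {y w : EuclideanSpace ℝ (Fin n)} :
    y - w ∈ ballPlus C ((fun v => v - w) '' X) ↔ y ∈ ballPlus C X := by
  simp [mem_ballPlus]

theorem ballPlus_closure {n : ℕ} {C : Set (EuclideanSpace ℝ (Fin n))} (hC : IsClosed C)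
    (X : Set (EuclideanSpace ℝ (Fin n))) : ballPlus C (closure X) = ballPlus C X := by
  ext y
  simp only [mem_ballPlus]
  refine ⟨fun h v hv => h v (subset_closure hv), fun h v hv => ?_⟩
  exact sub_mem_of_mem_closure hC (A := {y}) (by simpa using h) (subset_closure rfl) hv

/-- The members of `familyDT` other than the whole space. -/
def boundedFamilyDT {n : ℕ} (C : Set (EuclideanSpace ℝ (Fin n))) :
    Set (Set (EuclideanSpace ℝ (Fin n))) :=
  {K | ∃ X : Set (EuclideanSpace ℝ (Fin n)),
    X.Nonempty ∧ X ⊆ ballPlus C X ∧ K = ballPlus C X}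

theorem boundedFamilyDT_attained_and_stable {n : ℕ} {C : Set (EuclideanSpace ℝ (Fin n))}
    (hC : IsFullConvexBody C) (hF : (boundedFamilyDT C).Nonempty) :
    (∃ M ∈ boundedFamilyDT C, coveringNumber M = familyCoveringNumber (boundedFamilyDT C) ∧
      coveringNumber M ≠ ⊤) ∧
      ∃ δ : ℝ, 1 < δ ∧ ∀ K L : Set (EuclideanSpace ℝ (Fin n)), L ∈ boundedFamilyDT C →
        banachMazurDist K L < ENNReal.ofReal δ →
          coveringNumber K ≤ familyCoveringNumber (boundedFamilyDT C) := by
  refine familyCoveringNumber_attained_and_stable_of_basedCenters hC hF (fun L hL => hL)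
    (isClosed_basedCenters hC.1.isClosed) subset_rfl (fun X hX => ⟨X, X.nonempty, hX.2, rfl⟩) ?_
  rintro _ ⟨X, ⟨x, hx⟩, hXC, rfl⟩
  -- Translate a center to the origin; the closure makes the set compact without changing `B⁺`.
  set A := (fun v => v - x) '' X with hA
  have h0 : (0 : EuclideanSpace ℝ (Fin n)) ∈ closure A :=
    subset_closure ⟨x, hx, sub_self x⟩
  have hsub : closure A ⊆ ballPlus C (closure A) := by
    refine fun y hy => mem_ballPlus.2 fun v hv => sub_mem_of_mem_closure hC.1.isClosed ?_ hy hv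
    rintro _ ⟨y, hy, rfl⟩ _ ⟨v, hv, rfl⟩
    simpa using mem_ballPlus.1 (hXC hy) v hv
  have hAc : IsCompact (closure A) :=
    (isCompact_ballPlus hC.1 ⟨0, h0⟩).of_isClosed_subset isClosed_closure hsub
  refine ⟨⟨⟨closure A, hAc⟩, ⟨0, h0⟩⟩, ⟨h0, hsub⟩, x, fun y => ?_⟩
  change _ ↔ _ ∈ ballPlus C (closure A)
  rw [ballPlus_closure hC.1.isClosed, mem_ballPlus_image_sub]

theorem nonempty_of_mem_familyD {n : ℕ} {C K : Set (EuclideanSpace ℝ (Fin n))}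
    (hK : K ∈ familyD C) : K.Nonempty := by
  rw [Set.nonempty_iff_ne_empty]
  rintro rfl
  have h : (0 : EuclideanSpace ℝ (Fin n)) ∈ ballPlus C ∅ := mem_ballPlus.2 (by simp)
  rw [← show ∅ = ballPlus C ∅ from hK] at h
  exact h

theorem familyD_attained_and_stable {n : ℕ} {C : Set (EuclideanSpace ℝ (Fin n))}
    (hC : IsFullConvexBody C) (hF : (familyD C).Nonempty) :
    (∃ M ∈ familyD C, coveringNumber M = familyCoveringNumber (familyD C) ∧
      coveringNumber M ≠ ⊤) ∧
      ∃ δ : ℝ, 1 < δ ∧ ∀ K L : Set (EuclideanSpace ℝ (Fin n)), L ∈ familyD C →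
        banachMazurDist K L < ENNReal.ofReal δ →
          coveringNumber K ≤ familyCoveringNumber (familyD C) := by
  refine familyCoveringNumber_attained_and_stable_of_basedCenters hC hF
    (fun L hL => ⟨L, nonempty_of_mem_familyD hL, Eq.subset hL, hL⟩)
    (isClosed_basedComplete hC) (basedComplete_subset C)
    (fun X hX => congrArg (ballPlus C) hX.2) fun L hL => ?_
  obtain ⟨x, hx⟩ := nonempty_of_mem_familyD hL
  have hL' : L = ballPlus C L := hL
  set A := (fun v => v - x) '' L with hA
  have h0 : (0 : EuclideanSpace ℝ (Fin n)) ∈ A := ⟨x, hx, sub_self x⟩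
  have hmem (y) : y - x ∈ ballPlus C A ↔ y ∈ L := by
    rw [hA, mem_ballPlus_image_sub, ← hL']
  have hAeq : A = ballPlus C A := by
    ext y
    rw [← add_sub_cancel_right y x, hmem, hA]
    simp [sub_eq_iff_eq_add]
  refine ⟨⟨⟨A, hAeq ▸ isCompact_ballPlus hC.1 ⟨0, h0⟩⟩, ⟨0, h0⟩⟩, ⟨h0, hAeq⟩, x, fun y => ?_⟩
  exact (hmem y).symm

/-! ### The whole space as a degenerate member, and the theorem -/

theorem mem_familyDT_iff {n : ℕ} {C K : Set (EuclideanSpace ℝ (Fin n))} :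
    K ∈ familyDT C ↔ K = Set.univ ∨ K ∈ boundedFamilyDT C := by
  constructor
  · rintro ⟨X, hX, rfl⟩
    rcases X.eq_empty_or_nonempty with rfl | h
    · exact Or.inl (by simp [ballPlus])
    · exact Or.inr ⟨X, h, hX, rfl⟩
  · rintro (rfl | ⟨X, -, hX, rfl⟩)
    · exact ⟨∅, by simp, by simp [ballPlus]⟩
    · exact ⟨X, hX, rfl⟩

theorem coveringNumber_univ_le {n : ℕ} :
    coveringNumber (Set.univ : Set (EuclideanSpace ℝ (Fin n))) ≤ 1 := by
  refine coveringNumber_le (m := 1) (isCoveredByHomothets_iff.2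
    ⟨fun _ => 1 / 2, fun _ => 0, fun _ => by norm_num, fun x _ => ⟨0, (2 : ℝ) • x, trivial, ?_⟩⟩)
  module

theorem one_le_coveringNumber {n : ℕ} {K : Set (EuclideanSpace ℝ (Fin n))} (hK : K.Nonempty) :
    1 ≤ coveringNumber K := by
  refine le_iInf₂ fun m hm => ?_
  obtain ⟨x, hx⟩ := hK
  obtain ⟨r, v, -, hcov⟩ := isCoveredByHomothets_iff.1 hm
  obtain ⟨j, -⟩ := hcov x hx
  exact_mod_cast (Nat.zero_le _).trans_lt j.2

theorem banachMazurDist_univ {n : ℕ} (hn : 0 < n) {K : Set (EuclideanSpace ℝ (Fin n))}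
    (hK : IsCompact K) : banachMazurDist K Set.univ = ⊤ := by
  refine iInf₂_eq_top.2 fun r ⟨_, T, v, _, h⟩ => ?_
  have : Nonempty (Fin n) := ⟨⟨0, hn⟩⟩
  rw [Set.image_univ_of_surjective T.surjective, Set.univ_subset_iff] at h
  exact absurd (h ▸ (hK.smul r).vadd v) (noncompact_univ _)

theorem mainTheorem3 (n : ℕ) (hn : 0 < n) (C : Set (EuclideanSpace ℝ (Fin n)))
    (hC : IsFullConvexBody C) :
    -- the maxima defining the covering numbers of the two families exist and are finite
    ((familyD C).Nonempty →
      ∃ M ∈ familyD C, coveringNumber M = familyCoveringNumber (familyD C) ∧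
        coveringNumber M ≠ ⊤) ∧
    ((familyDT C).Nonempty →
      ∃ M ∈ familyDT C, coveringNumber M = familyCoveringNumber (familyDT C) ∧
        coveringNumber M ≠ ⊤) ∧
    -- the stability statements
    ∃ δ : ℝ, 1 < δ ∧
      (∀ K L : Set (EuclideanSpace ℝ (Fin n)), IsFullConvexBody K → L ∈ familyD C →
        banachMazurDist K L < ENNReal.ofReal δ →
        coveringNumber K ≤ familyCoveringNumber (familyD C)) ∧
      (∀ K L : Set (EuclideanSpace ℝ (Fin n)), IsFullConvexBody K → L ∈ familyDT C →
        banachMazurDist K L < ENNReal.ofReal δ →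
        coveringNumber K ≤ familyCoveringNumber (familyDT C)) := by
  refine ⟨fun h => (familyD_attained_and_stable hC h).1, fun _ => ?_, ?_⟩
  · rcases (boundedFamilyDT C).eq_empty_or_nonempty with h | h
    · have hF : familyDT C = {Set.univ} := by
        ext K
        simp [mem_familyDT_iff, h]
      refine ⟨Set.univ, by simp [hF], by simp [hF, familyCoveringNumber], ?_⟩
      exact ne_top_of_le_ne_top ENat.one_ne_top coveringNumber_univ_le
    · obtain ⟨⟨M, hM, hmax, hfin⟩, -⟩ := boundedFamilyDT_attained_and_stable hC h
      have hMT : M ∈ familyDT C := mem_familyDT_iff.2 (Or.inr hM)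
      refine ⟨M, hMT, le_antisymm (le_sSup ⟨M, hMT, rfl⟩) (sSup_le ?_), hfin⟩
      rintro _ ⟨L, hL, rfl⟩
      rcases mem_familyDT_iff.1 hL with rfl | hL
      -- The whole space does not raise the supremum: its covering number is at most 1.
      · obtain ⟨X, hX, hXC, rfl⟩ := hM
        exact coveringNumber_univ_le.trans (one_le_coveringNumber (hX.mono hXC))
      · exact hmax ▸ le_sSup ⟨L, hL, rfl⟩
  · obtain ⟨δ₁, hδ₁, h₁⟩ : ∃ δ : ℝ, 1 < δ ∧ ∀ K L : Set (EuclideanSpace ℝ (Fin n)),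
        L ∈ familyD C → banachMazurDist K L < ENNReal.ofReal δ →
          coveringNumber K ≤ familyCoveringNumber (familyD C) := by
      rcases (familyD C).eq_empty_or_nonempty with h | h
      · exact ⟨2, one_lt_two, fun K L hL => by simp [h] at hL⟩
      · exact (familyD_attained_and_stable hC h).2
    obtain ⟨δ₂, hδ₂, h₂⟩ : ∃ δ : ℝ, 1 < δ ∧ ∀ K L : Set (EuclideanSpace ℝ (Fin n)),
        L ∈ boundedFamilyDT C → banachMazurDist K L < ENNReal.ofReal δ →
          coveringNumber K ≤ familyCoveringNumber (boundedFamilyDT C) := by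
      rcases (boundedFamilyDT C).eq_empty_or_nonempty with h | h
      · exact ⟨2, one_lt_two, fun K L hL => by simp [h] at hL⟩
      · exact (boundedFamilyDT_attained_and_stable hC h).2
    refine ⟨min δ₁ δ₂, lt_min hδ₁ hδ₂, fun K L _ hL hKL => h₁ K L hL ?_, fun K L hK hL hKL => ?_⟩
    · exact hKL.trans_le (ENNReal.ofReal_le_ofReal (min_le_left _ _))
    · rcases mem_familyDT_iff.1 hL with rfl | hL
      · rw [banachMazurDist_univ hn hK.1] at hKL
        exact absurd hKL not_top_lt
      · refine (h₂ K L hL (hKL.trans_le (ENNReal.ofReal_le_ofReal (min_le_right _ _)))).trans ?_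
        exact sSup_le_sSup (Set.image_mono fun M hM => mem_familyDT_iff.2 (Or.inr hM))
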